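/- Write $\mathfrak{C}^\infty(\mathbb{R},\mathbb{R}^{\mathtt n})$ for the smooth functions $\mathbb{R}\to\mathbb{R}^{\mathtt n}$, and let $\mathfrak{L}^{\mathtt n}$ be the set of linear differential behaviors $\{v\in\mathfrak{C}^\infty(\mathbb{R},\mathbb{R}^{\mathtt n}) \mid R(\tfrac{\mathrm d}{\mathrm dt})v=0\}$ with $R\in\mathbb{R}[\xi]^{\mathtt g\times\mathtt n}$, $\mathtt g\ge 1$. Let $\mathcal P_i\in\mathfrak{L}^{\mathtt w_i+\mathtt s_i+\mathtt c_i}$ and $\mathcal K_i\in\mathfrak{L}^{\mathtt w_i+\mathtt k_i}$, $i=1,\dots,L$, with trajectories $(w_i,s_i,c_i)\in\mathcal P_i$ and $(w_i,k_i)\in\mathcal K_i$, where the connection variables are partitioned as $s_i=(s_{ij})_j$ and $k_i=(k_{ij})_j$ and are shared between subsystems: $s_{ij}=s_{ji}$ and $k_{ij}=k_{ji}$. Write $w=(w_i)_i$, $s=(s_i)_i$, $c=(c_i)_i$, $k=(k_i)_i$. For a behavior $\mathcal B$ and some of its variables $x$, let $(\mathcal B)_x$ be the manifest behavior with respect to $x$,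 that is, the set of all $x$ for which there is a trajectory of the remaining variables such that the joint trajectory is in $\mathcal B$. Define the interconnected plant and the interconnected desired system by \[ \mathcal P_{\mathcal I}=\{(w,s,c)\mid (w_i,s_i,c_i)\in\mathcal P_i \text{ for all } i\},\qquad \mathcal K_{\mathcal I}=\{(w,k)\mid (w_i,k_i)\in\mathcal K_i\text{ for all } i\}, \] and the hidden behavior $\mathcal N(\mathcal P_{\mathcal I})=\{w\mid (w,0)\in(\mathcal P_{\mathcal I})_{(w,c)}\}$. Define the local canonical controllers and the canonical distributed controller by \[ \mathcal C_i^{\mathrm{can}}=\{(c_i,s_i,k_i)\mid \exists w_i:\ (w_i,s_i,c_i)\in\mathcal P_i\text{ and }(w_i,k_i)\in\mathcal K_i\}, \] \[ \mathcal C_{\mathcal I}^{\mathrm{can}}=\{(c,s,k)\mid (c_i,s_i,k_i)\in\mathcal C_i^{\mathrm{can}}\text{ for all } i\}, \] where the latter again uses $s_{ij}=s_{ji}$, $k_{ij}=k_{ji}$. The controller is interconnected with the plant through $c$ only, so that $\mathcal P_{\mathcal I}\wedge_c\mathcal C_{\mathcal I}^{\mathrm{can}}=\{(w,s,c,(s',k'))\mid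 (w,s,c)\in\mathcal P_{\mathcal I}\text{ and }(c,s',k')\in\mathcal C_{\mathcal I}^{\mathrm{can}}\}$, and it is said to implement $\mathcal K_{\mathcal I}$ if $(\mathcal K_{\mathcal I})_w=(\mathcal P_{\mathcal I}\wedge_c\mathcal C_{\mathcal I}^{\mathrm{can}})_w$. Then $\mathcal C_{\mathcal I}^{\mathrm{can}}$ implements $\mathcal K_{\mathcal I}$ if and only if \[ \mathcal N(\mathcal P_{\mathcal I})\subseteq(\mathcal K_{\mathcal I})_w\subseteq(\mathcal P_{\mathcal I})_w . \] -/

import Mathlib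

open scoped Polynomial ContDiff

namespace DistrControl

/-- A behavior with time axis `ℝ` whose scalar real variables are labelled by `ι`:
a set of trajectories `ℝ → ℝ^ι`. -/
abbrev Behavior (ι : Type) : Type := Set (ℝ → ι → ℝ)

/-- The trajectory of the variables `κ` that is read off from a trajectory `u` of the variables
`ι`, when the variable `k : κ` is the variable `e k : ι`. -/
def pull {κ ι : Type} (e : κ → ι) (u : ℝ → ι → ℝ) : ℝ → κ → ℝ := fun t k => u t (e k)

/-- The joint trajectory `(u, v)`. -/
def pair {α β : Type} (u : ℝ → α → ℝ) (v : ℝ → β → ℝ) : ℝ → α ⊕ β → ℝ :=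
  fun t => Sum.elim (u t) (v t)

/-- The manifest behavior of `B` with respect to the variables selected by `e` (the remaining
variables are eliminated, i.e. existentially quantified). -/
def manifest {κ ι : Type} (e : κ → ι) (B : Behavior ι) : Behavior κ :=
  {v | ∃ u ∈ B, pull e u = v}

/-- Interconnection of two behaviors by variable sharing: `G` is the set of all variables,
`e₁` and `e₂` tell which of them are the variables of `B₁` and of `B₂`; the variables in the
range of both are shared. -/
def interconnect₂ {V₁ V₂ G : Type} (e₁ : V₁ → G) (e₂ : V₂ → G)
    (B₁ : Behavior V₁) (B₂ : Behavior V₂) : Behavior G :=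
  {u | pull e₁ u ∈ B₁ ∧ pull e₂ u ∈ B₂}

/-- Interconnection of a family of behaviors by variable sharing. -/
def interconnect {I G : Type} {V : I → Type} (e : ∀ i, V i → G)
    (B : ∀ i, Behavior (V i)) : Behavior G :=
  {u | ∀ i, pull (e i) u ∈ B i}

/-- The scalar differential operator `p(d/dt)`. -/
noncomputable def diffOp (p : ℝ[X]) (f : ℝ → ℝ) : ℝ → ℝ :=
  fun t => p.sum fun n a => a * iteratedDeriv n f t

/-- The set of smooth solutions of `R(d/dt) w = 0`. -/
def kernelBehavior {ι : Type} [Fintype ι] {g : ℕ} (R : Matrix (Fin g) ι ℝ[X]) : Behavior ι :=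
  {w | ContDiff ℝ ∞ w ∧ ∀ (r : Fin g) (t : ℝ), ∑ b, diffOp (R r b) (fun τ => w τ b) t = 0}

/-- `B` is (the behavior of) a linear differential system: it has a kernel representation. -/
def IsLinearDifferential {ι : Type} [Fintype ι] (B : Behavior ι) : Prop :=
  ∃ (g : ℕ) (_ : 0 < g) (R : Matrix (Fin g) ι ℝ[X]), B = kernelBehavior R

section Variables

/-- The scalar components of `(x_1, …, x_L)`, where `x_i` has `n i` components. -/
abbrev LocalVar {L : ℕ} (n : Fin L → ℕ) : Type := Σ i : Fin L, Fin (n i)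

/-- The scalar components of all the connection variables: the variable shared by the subsystems
`i` and `j` has `n s(i, j)` components and is attached to the unordered pair `s(i, j)`, so that
`x_ij` and `x_ji` are the same variable. -/
abbrev ConnVar {L : ℕ} (n : Sym2 (Fin L) → ℕ) : Type := Σ p : Sym2 (Fin L), Fin (n p)

/-- The scalar components of the connection variable `x_i = (x_i1, …, x_iL)` of subsystem `i`. -/
abbrev ConnVarAt {L : ℕ} (n : Sym2 (Fin L) → ℕ) (i : Fin L) : Type :=
  Σ j : Fin L, Fin (n s(i, j))

/-- The components of `x_i` among those of `(x_1, …, x_L)`. -/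
def localIncl {L : ℕ} (n : Fin L → ℕ) (i : Fin L) : Fin (n i) → LocalVar n := fun a => ⟨i, a⟩

/-- The components of the connection variable of subsystem `i` among all connection variables. -/
def connIncl {L : ℕ} (n : Sym2 (Fin L) → ℕ) (i : Fin L) : ConnVarAt n i → ConnVar n :=
  fun x => ⟨s(i, x.1), x.2⟩

end Variables

/-- The interconnected plant `P_I`, with variables `(w, s, c)`. -/
def plantInterconnection {L : ℕ} {nw nc : Fin L → ℕ} {ns : Sym2 (Fin L) → ℕ}
    (P : ∀ i, Behavior (Fin (nw i) ⊕ ConnVarAt ns i ⊕ Fin (nc i))) :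
    Behavior (LocalVar nw ⊕ ConnVar ns ⊕ LocalVar nc) :=
  interconnect (fun i => Sum.map (localIncl nw i) (Sum.map (connIncl ns i) (localIncl nc i))) P

/-- The interconnected desired system `K_I`, with variables `(w, k)`. -/
def desiredInterconnection {L : ℕ} {nw : Fin L → ℕ} {nk : Sym2 (Fin L) → ℕ}
    (K : ∀ i, Behavior (Fin (nw i) ⊕ ConnVarAt nk i)) :
    Behavior (LocalVar nw ⊕ ConnVar nk) :=
  interconnect (fun i => Sum.map (localIncl nw i) (connIncl nk i)) K

/-- The canonical controller `(P ∧_w K)_{(c, s, k)}` of a plant `P` with variables `(w, s, c)` and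
a desired behavior `K` with variables `(w, k)`. The interconnection `P ∧_w K` has the variables
`(w, s, c, k)`. -/
def localCanonical {W S C K' : Type} (P : Behavior (W ⊕ S ⊕ C)) (K : Behavior (W ⊕ K')) :
    Behavior (C ⊕ S ⊕ K') :=
  manifest
    (Sum.elim (fun c => Sum.inr (Sum.inr (Sum.inl c)))
      (Sum.elim (fun s => Sum.inr (Sum.inl s)) (fun k => Sum.inr (Sum.inr (Sum.inr k)))))
    (interconnect₂ (G := W ⊕ S ⊕ C ⊕ K')
      (Sum.map id (Sum.map id Sum.inl))
      (Sum.map id (fun k => Sum.inr (Sum.inr k)))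
      P K)

/-- The canonical distributed controller: the interconnection of the local canonical controllers
through `(s_i, k_i)`. Its variables are `(c, s, k)`. -/
def canonicalController {L : ℕ} {nw nc : Fin L → ℕ} {ns nk : Sym2 (Fin L) → ℕ}
    (P : ∀ i, Behavior (Fin (nw i) ⊕ ConnVarAt ns i ⊕ Fin (nc i)))
    (K : ∀ i, Behavior (Fin (nw i) ⊕ ConnVarAt nk i)) :
    Behavior (LocalVar nc ⊕ ConnVar ns ⊕ ConnVar nk) :=
  interconnect (fun i => Sum.map (localIncl nc i) (Sum.map (connIncl ns i) (connIncl nk i)))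
    (fun i => localCanonical (P i) (K i))

/-- `P ∧_c C`: the plant with variables `(w, s, c)` and the controller with variables `(c, p)`
share the control variable `c` only. The interconnection has the variables `(w, s, c, p)`. -/
def controlled {W S C Q : Type} (P : Behavior (W ⊕ S ⊕ C)) (Ctr : Behavior (C ⊕ Q)) :
    Behavior (W ⊕ S ⊕ C ⊕ Q) :=
  interconnect₂ (Sum.map id (Sum.map id Sum.inl)) (fun x => Sum.inr (Sum.inr x)) P Ctr

/-- The controller `Ctr` with variables `(c, p)` implements the desired system `K` with
variables `(w, k)` for the plant `P` with variables `(w, s, c)`: `(K)_w = (P ∧_c Ctr)_w`. -/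
def Implements {W S C K' Q : Type} (Ctr : Behavior (C ⊕ Q)) (P : Behavior (W ⊕ S ⊕ C))
    (K : Behavior (W ⊕ K')) : Prop :=
  manifest Sum.inl K = manifest Sum.inl (controlled P Ctr)

/-- The manifest behavior `(P)_{(w, c)}` of a plant with variables `(w, s, c)`. -/
def manifestWC {W S C : Type} (P : Behavior (W ⊕ S ⊕ C)) : Behavior (W ⊕ C) :=
  manifest (Sum.map id Sum.inr) P

/-- The hidden behavior `{w | (w, 0) ∈ (P)_{(w, c)}}`. -/
def hidden {W S C : Type} (P : Behavior (W ⊕ S ⊕ C)) : Behavior W :=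
  {w | pair w 0 ∈ manifestWC P}

end DistrControl

namespace DistrControl

/-! The variables `w_i` are not shared between subsystems, so local choices of `w_i` glue to one
`w`. Hence the canonical distributed controller is the canonical controller of the interconnected
plant and desired system (`canonicalController_eq_localCanonical`), and the problem becomes
centralized. There only linearity matters (`implements_localCanonical_iff`). A controlled `w` is one
that shares its control trajectory `c` with some plant trajectory whose `w'` is desired. Then `w -
w'` belongs to `c = 0`, so it is hidden; if hidden trajectories are desired, so is `w = (w - w') +
w'`. -/

theorem diffOp_add (p : ℝ[X]) {f g : ℝ → ℝ} (hf : ContDiff ℝ ∞ f) (hg : ContDiff ℝ ∞ g) (t : ℝ) :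
    diffOp p (fun τ => f τ + g τ) t = diffOp p f t + diffOp p g t := by
  simp only [diffOp, Polynomial.sum_def, ← Finset.sum_add_distrib]
  refine Finset.sum_congr rfl fun n _ => ?_
  have hn : (n : WithTop ℕ∞) ≤ ∞ := by exact_mod_cast le_top
  rw [iteratedDeriv_fun_add (hf.of_le hn).contDiffAt (hg.of_le hn).contDiffAt, mul_add]

theorem diffOp_const_mul (p : ℝ[X]) {f : ℝ → ℝ} (hf : ContDiff ℝ ∞ f) (a t : ℝ) :
    diffOp p (fun τ => a * f τ) t = a * diffOp p f t := by
  simp only [diffOp, Polynomial.sum_def, Finset.mul_sum]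
  refine Finset.sum_congr rfl fun n _ => ?_
  have hn : (n : WithTop ℕ∞) ≤ ∞ := by exact_mod_cast le_top
  rw [iteratedDeriv_const_mul a (hf.of_le hn).contDiffAt]
  ring

theorem diffOp_zero (p : ℝ[X]) (t : ℝ) : diffOp p (fun _ => 0) t = 0 := by
  simpa using diffOp_const_mul p (f := fun _ => 0) contDiff_const 0 t

/-- A kernel behavior is a linear subspace of the space of trajectories. -/
def kernelSubmodule {ι : Type} [Fintype ι] {g : ℕ} (R : Matrix (Fin g) ι ℝ[X]) :
    Submodule ℝ (ℝ → ι → ℝ) where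
  carrier := kernelBehavior R
  zero_mem' := ⟨contDiff_const, fun r t => Finset.sum_eq_zero fun b _ => diffOp_zero (R r b) t⟩
  add_mem' := by
    rintro u v ⟨hu, hu'⟩ ⟨hv, hv'⟩
    refine ⟨hu.add hv, fun r t => ?_⟩
    -- The right-hand side becomes `0 + 0`, and each zero is replaced by the equation of `u` or `v`,
    -- to compare the sums termwise.
    rw [← add_zero (0 : ℝ)]
    nth_rw 1 [← hu' r t]
    rw [← hv' r t, ← Finset.sum_add_distrib]
    exact Finset.sum_congr rfl fun b _ =>
      diffOp_add (R r b) (contDiff_pi.1 hu b) (contDiff_pi.1 hv b) t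
  smul_mem' := by
    rintro a u ⟨hu, hu'⟩
    refine ⟨contDiff_const.smul hu, fun r t => ?_⟩
    rw [← mul_zero a, ← hu' r t, Finset.mul_sum]
    exact Finset.sum_congr rfl fun b _ => diffOp_const_mul (R r b) (contDiff_pi.1 hu b) a t

/-- From here on the differential structure is forgotten; only closure under linear combinations is
kept. -/
theorem IsLinearDifferential.exists_submodule {ι : Type} [Fintype ι] {B : Behavior ι}
    (h : IsLinearDifferential B) : ∃ S : Submodule ℝ (ℝ → ι → ℝ), (S : Set (ℝ → ι → ℝ)) = B := by
  obtain ⟨g, -, R, rfl⟩ := h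
  exact ⟨kernelSubmodule R, rfl⟩

/-- Each `pull` is linear, so an interconnection is an intersection of preimages of subspaces. -/
theorem exists_submodule_interconnect {I G : Type} {V : I → Type} (e : ∀ i, V i → G)
    {B : ∀ i, Behavior (V i)}
    (h : ∀ i, ∃ S : Submodule ℝ (ℝ → V i → ℝ), (S : Set (ℝ → V i → ℝ)) = B i) :
    ∃ S : Submodule ℝ (ℝ → G → ℝ), (S : Set (ℝ → G → ℝ)) = interconnect e B := by
  choose S hS using h
  obtain rfl : (fun i => (S i : Set (ℝ → V i → ℝ))) = B := funext hS
  exact ⟨{ carrier := interconnect e fun i => S i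
           zero_mem' := fun i => (S i).zero_mem
           add_mem' := fun hu hv i => (S i).add_mem (hu i) (hv i)
           smul_mem' := fun a _ hu i => (S i).smul_mem a (hu i) }, rfl⟩

theorem mem_localCanonical {W S C K' : Type} {P : Behavior (W ⊕ S ⊕ C)} {K : Behavior (W ⊕ K')}
    {u : ℝ → C ⊕ S ⊕ K' → ℝ} :
    u ∈ localCanonical P K ↔ ∃ w : ℝ → W → ℝ,
      pair w (pair (pull (Sum.inr ∘ Sum.inl) u) (pull Sum.inl u)) ∈ P ∧
      pair w (pull (Sum.inr ∘ Sum.inr) u) ∈ K := by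
  constructor
  · rintro ⟨x, ⟨hP, hK⟩, rfl⟩
    refine ⟨pull Sum.inl x, ?_, ?_⟩
    · convert hP using 1
      funext t v
      rcases v with v | v | v <;> rfl
    · convert hK using 1
      funext t v
      rcases v with v | v <;> rfl
  · rintro ⟨w, hP, hK⟩
    refine ⟨pair w (pair (pull (Sum.inr ∘ Sum.inl) u)
      (pair (pull Sum.inl u) (pull (Sum.inr ∘ Sum.inr) u))), ⟨?_, ?_⟩, ?_⟩
    · convert hP using 1
      funext t v
      rcases v with v | v | v <;> rfl
    · convert hK using 1
      funext t v
      rcases v with v | v <;> rfl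
    · funext t v
      rcases v with v | v | v <;> rfl

theorem mem_manifest_inl {W V : Type} {B : Behavior (W ⊕ V)} {w : ℝ → W → ℝ} :
    w ∈ manifest Sum.inl B ↔ ∃ v, pair w v ∈ B := by
  constructor
  · rintro ⟨u, hu, rfl⟩
    refine ⟨pull Sum.inr u, ?_⟩
    convert hu using 1
    funext t x
    rcases x with x | x <;> rfl
  · rintro ⟨v, hv⟩
    exact ⟨_, hv, rfl⟩

theorem mem_hidden {W S C : Type} {P : Behavior (W ⊕ S ⊕ C)} {w : ℝ → W → ℝ} :
    w ∈ hidden P ↔ ∃ s, pair w (pair s 0) ∈ P := by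
  constructor
  · rintro ⟨u, hu, h⟩
    refine ⟨pull (Sum.inr ∘ Sum.inl) u, ?_⟩
    convert hu using 1
    funext t x
    rcases x with x | x | x
    · exact (congr_fun (congr_fun h t) (Sum.inl x)).symm
    · rfl
    · exact (congr_fun (congr_fun h t) (Sum.inr x)).symm
  · rintro ⟨s, hs⟩
    refine ⟨_, hs, ?_⟩
    funext t x
    rcases x with x | x <;> rfl

/-- The variables shown by the plant controlled by its canonical controller. -/
theorem mem_manifest_controlled_localCanonical {W S C K' : Type} {P : Behavior (W ⊕ S ⊕ C)}
    {K : Behavior (W ⊕ K')} {w : ℝ → W → ℝ} :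
    w ∈ manifest Sum.inl (controlled P (localCanonical P K)) ↔
      ∃ s c w' s' k', pair w (pair s c) ∈ P ∧ pair w' (pair s' c) ∈ P ∧ pair w' k' ∈ K := by
  constructor
  · rintro ⟨u, ⟨hP, hC⟩, rfl⟩
    obtain ⟨w', hP', hK'⟩ := mem_localCanonical.1 hC
    refine ⟨pull (Sum.inr ∘ Sum.inl) u, _, w', _, _, ?_, hP', hK'⟩
    convert hP using 1
    funext t x
    rcases x with x | x | x <;> rfl
  · rintro ⟨s, c, w', s', k', hP, hP', hK'⟩
    refine ⟨pair w (pair s (pair c (pair s' k'))), ⟨?_, mem_localCanonical.2 ⟨w', hP', hK'⟩⟩, rfl⟩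
    convert hP using 1
    funext t x
    rcases x with x | x | x <;> rfl

/-- The canonical distributed controller is the canonical controller of the interconnected
plant and the interconnected desired system. -/
theorem canonicalController_eq_localCanonical {L : ℕ} {nw nc : Fin L → ℕ}
    {ns nk : Sym2 (Fin L) → ℕ}
    (P : ∀ i, Behavior (Fin (nw i) ⊕ ConnVarAt ns i ⊕ Fin (nc i)))
    (K : ∀ i, Behavior (Fin (nw i) ⊕ ConnVarAt nk i)) :
    canonicalController P K =
      localCanonical (plantInterconnection P) (desiredInterconnection K) := by
  ext u
  rw [mem_localCanonical]
  constructor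
  · intro h
    choose w hP hK using fun i => mem_localCanonical.1 (h i)
    -- The gluing of the `w_i`; no compatibility is needed because each component of `w` belongs to
    -- exactly one subsystem.
    refine ⟨fun t x => w x.1 t x.2, fun i => ?_, fun i => ?_⟩
    · convert hP i using 1
      funext t x
      rcases x with x | x | x <;> rfl
    · convert hK i using 1
      funext t x
      rcases x with x | x <;> rfl
  · rintro ⟨w, hP, hK⟩ i
    refine mem_localCanonical.2 ⟨pull (localIncl nw i) w, ?_, ?_⟩
    · convert hP i using 1
      funext t x
      rcases x with x | x | x <;> rfl
    · convert hK i using 1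
      funext t x
      rcases x with x | x <;> rfl

theorem pair_add {α β : Type} (u u' : ℝ → α → ℝ) (v v' : ℝ → β → ℝ) :
    pair (u + u') (v + v') = pair u v + pair u' v' := by
  funext t x
  rcases x with x | x <;> rfl

theorem pair_sub {α β : Type} (u u' : ℝ → α → ℝ) (v v' : ℝ → β → ℝ) :
    pair (u - u') (v - v') = pair u v - pair u' v' := by
  funext t x
  rcases x with x | x <;> rfl

theorem pair_zero {α β : Type} : pair (0 : ℝ → α → ℝ) (0 : ℝ → β → ℝ) = 0 := by
  funext t x
  rcases x with x | x <;> rfl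

theorem implements_localCanonical_iff {W S C K' : Type}
    (P : Submodule ℝ (ℝ → W ⊕ S ⊕ C → ℝ)) (K : Submodule ℝ (ℝ → W ⊕ K' → ℝ)) :
    Implements (localCanonical (P : Set (ℝ → W ⊕ S ⊕ C → ℝ)) (K : Set (ℝ → W ⊕ K' → ℝ)))
        (P : Set (ℝ → W ⊕ S ⊕ C → ℝ)) (K : Set (ℝ → W ⊕ K' → ℝ)) ↔
      hidden (P : Set (ℝ → W ⊕ S ⊕ C → ℝ)) ⊆ manifest Sum.inl (K : Set (ℝ → W ⊕ K' → ℝ)) ∧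
      manifest Sum.inl (K : Set (ℝ → W ⊕ K' → ℝ)) ⊆
        manifest Sum.inl (P : Set (ℝ → W ⊕ S ⊕ C → ℝ)) := by
  constructor
  · intro h
    refine ⟨fun w hw => ?_, fun w hw => ?_⟩
    · obtain ⟨s, hs⟩ := mem_hidden.1 hw
      rw [h]
      -- A hidden `w` occurs with `c = 0`, which the controller accepts through the zero
      -- trajectories of plant and desired system.
      refine mem_manifest_controlled_localCanonical.2 ⟨s, 0, 0, 0, 0, hs, ?_, ?_⟩
      · simp only [pair_zero]
        exact P.zero_mem
      · simp only [pair_zero]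
        exact K.zero_mem
    · rw [h] at hw
      obtain ⟨s, c, -, -, -, hP, -⟩ := mem_manifest_controlled_localCanonical.1 hw
      exact mem_manifest_inl.2 ⟨_, hP⟩
  · rintro ⟨hN, hKP⟩
    refine Set.Subset.antisymm (fun w hw => ?_) (fun w hw => ?_)
    · obtain ⟨u, hu, rfl⟩ := hKP hw
      obtain ⟨k, hk⟩ := mem_manifest_inl.1 hw
      have huP : pair (pull Sum.inl u) (pair (pull (Sum.inr ∘ Sum.inl) u)
          (pull (Sum.inr ∘ Sum.inr) u)) ∈ (P : Set (ℝ → W ⊕ S ⊕ C → ℝ)) := by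
        convert hu using 1
        funext t x
        rcases x with x | x | x <;> rfl
      -- The controller's internal copy of the plant runs along the very trajectory of the plant, so
      -- `w' = w` and `s' = s`.
      exact mem_manifest_controlled_localCanonical.2 ⟨_, _, _, _, k, huP, huP, hk⟩
    · obtain ⟨s, c, w', s', k', hP, hP', hK'⟩ := mem_manifest_controlled_localCanonical.1 hw
      have hdiff : w - w' ∈ hidden (P : Set (ℝ → W ⊕ S ⊕ C → ℝ)) := by
        refine mem_hidden.2 ⟨s - s', ?_⟩
        -- Both plant trajectories carry the same `c`, so the control part of their difference is `c
        -- - c = 0`.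
        rw [← sub_self c, pair_sub, pair_sub]
        exact P.sub_mem hP hP'
      obtain ⟨k, hk⟩ := mem_manifest_inl.1 (hN hdiff)
      refine mem_manifest_inl.2 ⟨k + k', ?_⟩
      rw [← sub_add_cancel w w', pair_add]
      exact K.add_mem hk hK'

end DistrControl

open DistrControl in
theorem proposition1 {L : ℕ} (nw nc : Fin L → ℕ) (ns nk : Sym2 (Fin L) → ℕ)
    (P : ∀ i : Fin L, Behavior (Fin (nw i) ⊕ ConnVarAt ns i ⊕ Fin (nc i)))
    (K : ∀ i : Fin L, Behavior (Fin (nw i) ⊕ ConnVarAt nk i))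
    (hP : ∀ i, IsLinearDifferential (P i))
    (hK : ∀ i, IsLinearDifferential (K i)) :
    Implements (canonicalController P K) (plantInterconnection P) (desiredInterconnection K) ↔
      hidden (plantInterconnection P) ⊆ manifest Sum.inl (desiredInterconnection K) ∧
      manifest Sum.inl (desiredInterconnection K) ⊆
        manifest Sum.inl (plantInterconnection P) := by
  obtain ⟨SP, hSP⟩ := exists_submodule_interconnect
    (fun i => Sum.map (localIncl nw i) (Sum.map (connIncl ns i) (localIncl nc i)))
    fun i => (hP i).exists_submodule
  obtain ⟨SK, hSK⟩ := exists_submodule_interconnect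
    (fun i => Sum.map (localIncl nw i) (connIncl nk i)) fun i => (hK i).exists_submodule
  rw [canonicalController_eq_localCanonical, plantInterconnection, desiredInterconnection,
    ← hSP, ← hSK]
  exact implements_localCanonical_iff SP SK
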